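/- **Theorem 1.1.** Let $a < c$ be real numbers and let $\mathrm{PL}_o([a,c])$ be the group, under composition, of all increasing piecewise linear homeomorphisms $g$ of $\mathbb{R}$ (with finitely many break points) whose support $\{t \in \mathbb{R} \mid g(t) \neq t\}$ lies in $[a,c]$. Let $\sigma_\ell(g)$ be the right derivative of $g$ in $a$ and $\sigma_r(g)$ the left derivative of $g$ in $c$; both are homomorphisms of $\mathrm{PL}_o([a,c])$ into the multiplicative group $\mathbb{R}^\times_{>0}$. For an arbitrary group $G$, let $S(G)$ be the set of all rays $[\chi] = \mathbb{R}_{>0}\cdot\chi$ with $\chi$ a non-zero homomorphism from $G$ to the additive group $\mathbb{R}$. For a generating set $\mathcal{X}$ of $G$, let $\Gamma(G,\mathcal{X})$ be the Cayley graph with vertex set $G$ and edges $(g, gx)$ for $g \in G$, $x \in \mathcal{X}$, and let $\Gamma(G,\mathcal{X})_\chi$ be its full subgraph on the vertices $g$ with $\chi(g)\ge 0$. Put $$\Sigma^1(G) = \{[\chi] \in S(G) \mid \Gamma(G,\mathcal{X})_\chi \text{ is connected for every generating set } \mathcal{X} \text{ of } G\}.$$ Let $G$ be a subgroup (not necessarily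 finitely generated) of $\mathrm{PL}_o([a,c])$. Denote the restrictions of $\sigma_\ell$, $\sigma_r$ to $G$ by the same symbols, put $\chi_\ell = \ln\circ\,\sigma_\ell$ and $\chi_r = \ln\circ\,\sigma_r$, and let $E(G) \subseteq S(G)$ be the set of the rays represented by those of the homomorphisms $\chi_\ell$, $\chi_r$ of $G$ that are non-zero. Suppose that $G$ is irreducible, i.e. no point of the open interval $(a,c)$ is fixed by all elements of $G$, and that $G/(\ker\sigma_\ell\cdot\ker\sigma_r)$ is a torsion group. Then $$\Sigma^1(G) = S(G) \smallsetminus E(G).$$ -/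

import Mathlib

open Set Filter Topology

namespace PLSigma

/-! ### Piecewise linear homeomorphisms of the line with support in `[a, c]` -/

/-- `f` is piecewise linear with finitely many break points: there is a finite set `B` such that
`f` is affine on every compact interval with no point of `B` in its interior. -/
def IsPL (f : ℝ → ℝ) : Prop :=
  ∃ B : Finset ℝ, ∀ x y : ℝ, x < y → (∀ b ∈ B, b ∉ Ioo x y) →
    ∃ m q : ℝ, ∀ t ∈ Icc x y, f t = m * t + q

theorem IsPL.comp {f g : ℝ ≃ₜ ℝ} (hf : IsPL f) (hg : IsPL g) (gm : StrictMono g) :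
    IsPL (f * g : ℝ ≃ₜ ℝ) := by
  classical
  obtain ⟨B, hB⟩ := hf
  obtain ⟨C, hC⟩ := hg
  refine ⟨C ∪ B.image g.symm, fun x y hxy h => ?_⟩
  obtain ⟨m, q, hm⟩ := hC x y hxy fun b hb => h b (Finset.mem_union_left _ hb)
  obtain ⟨n, r, hn⟩ := hB (g x) (g y) (gm hxy) fun b hb hbm =>
    h (g.symm b) (Finset.mem_union_right _ (Finset.mem_image_of_mem _ hb))
      ⟨gm.lt_iff_lt.1 (by simpa using hbm.1), gm.lt_iff_lt.1 (by simpa using hbm.2)⟩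
  refine ⟨n * m, n * q + r, fun t ht => ?_⟩
  rw [Homeomorph.mul_apply, hn (g t) ⟨gm.monotone ht.1, gm.monotone ht.2⟩, hm t ht]
  ring

theorem strictMono_symm {g : ℝ ≃ₜ ℝ} (gm : StrictMono g) : StrictMono g.symm := fun x y hxy =>
  gm.lt_iff_lt.1 (by simpa using hxy)

theorem IsPL.symm {g : ℝ ≃ₜ ℝ} (hg : IsPL g) (gm : StrictMono g) : IsPL g.symm := by
  classical
  obtain ⟨C, hC⟩ := hg
  refine ⟨C.image g, fun x y hxy h => ?_⟩
  have sm := strictMono_symm gm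
  obtain ⟨m, q, hm⟩ := hC (g.symm x) (g.symm y) (sm hxy) fun b hb hbm =>
    h (g b) (Finset.mem_image_of_mem _ hb)
      ⟨by simpa using gm hbm.1, by simpa using gm hbm.2⟩
  have hm0 : m ≠ 0 := by
    rintro rfl
    have h1 := hm (g.symm x) ⟨le_rfl, (sm hxy).le⟩
    have h2 := hm (g.symm y) ⟨(sm hxy).le, le_rfl⟩
    simp only [Homeomorph.apply_symm_apply] at h1 h2
    linarith
  refine ⟨m⁻¹, -(m⁻¹ * q), fun t ht => ?_⟩
  have := hm (g.symm t) ⟨sm.monotone ht.1, sm.monotone ht.2⟩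
  rw [Homeomorph.apply_symm_apply] at this
  field_simp
  linarith

/-- The group `PL_o([a, c])` of all orientation preserving (i.e. increasing) piecewise linear
homeomorphisms of the real line with support in `[a, c]`.  The product is composition,
`(f * g) t = f (g t)`. -/
def PLo (a c : ℝ) : Subgroup (ℝ ≃ₜ ℝ) where
  carrier := {g | StrictMono g ∧ IsPL g ∧ ∀ t, t ∉ Icc a c → g t = t}
  mul_mem' := by
    rintro f g ⟨fm, fp, fs⟩ ⟨gm, gp, gs⟩
    refine ⟨fm.comp gm, fp.comp gp gm, fun t ht => ?_⟩
    rw [Homeomorph.mul_apply, gs t ht, fs t ht]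
  one_mem' := ⟨strictMono_id, ⟨∅, fun _ _ _ _ => ⟨1, 0, fun t _ => by simp⟩⟩, fun _ _ => rfl⟩
  inv_mem' := by
    rintro g ⟨gm, gp, gs⟩
    refine ⟨strictMono_symm gm, gp.symm gm, fun t ht => ?_⟩
    rw [Homeomorph.inv_apply, Homeomorph.symm_apply_eq, gs t ht]

variable {a c : ℝ}

theorem apply_left (g : PLo a c) : (g : ℝ ≃ₜ ℝ) a = a := by
  have h1 : Tendsto (g : ℝ ≃ₜ ℝ) (𝓝[<] a) (𝓝 ((g : ℝ ≃ₜ ℝ) a)) :=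
    (g : ℝ ≃ₜ ℝ).continuous.continuousAt.tendsto.mono_left nhdsWithin_le_nhds
  have h2 : Tendsto (g : ℝ ≃ₜ ℝ) (𝓝[<] a) (𝓝 a) :=
    (tendsto_id.mono_left nhdsWithin_le_nhds).congr' <| by
      filter_upwards [self_mem_nhdsWithin] with t ht
      exact (g.2.2.2 t fun h => absurd h.1 (not_le.2 ht)).symm
  exact tendsto_nhds_unique h1 h2

theorem apply_right (g : PLo a c) : (g : ℝ ≃ₜ ℝ) c = c := by
  have h1 : Tendsto (g : ℝ ≃ₜ ℝ) (𝓝[>] c) (𝓝 ((g : ℝ ≃ₜ ℝ) c)) :=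
    (g : ℝ ≃ₜ ℝ).continuous.continuousAt.tendsto.mono_left nhdsWithin_le_nhds
  have h2 : Tendsto (g : ℝ ≃ₜ ℝ) (𝓝[>] c) (𝓝 c) :=
    (tendsto_id.mono_left nhdsWithin_le_nhds).congr' <| by
      filter_upwards [self_mem_nhdsWithin] with t ht
      exact (g.2.2.2 t fun h => absurd h.2 (not_le.2 ht)).symm
  exact tendsto_nhds_unique h1 h2

theorem exists_hasDeriv_left (g : PLo a c) :
    ∃ m : ℝ, 0 < m ∧ HasDerivWithinAt (g : ℝ ≃ₜ ℝ) m (Ici a) a := by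
  obtain ⟨gm, ⟨B, hB⟩, -⟩ := g.2
  have hev : ∀ᶠ y in 𝓝[>] a, ∀ b ∈ B, b ∉ Ioo a y := by
    refine (Filter.eventually_all_finset B).2 fun b _ => ?_
    rcases le_or_gt b a with h | h
    · exact Eventually.of_forall fun y hy => absurd hy.1 (not_lt.2 h)
    · filter_upwards [mem_nhdsWithin_of_mem_nhds (Iio_mem_nhds h)] with y hy hb
      exact lt_asymm hy hb.2
  obtain ⟨y, hyB, hay⟩ := (hev.and self_mem_nhdsWithin).exists
  have hay : a < y := hay
  obtain ⟨m, q, hm⟩ := hB a y hay hyB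
  refine ⟨m, ?_, ?_⟩
  · have h1 := hm a ⟨le_rfl, hay.le⟩
    have h2 := hm y ⟨hay.le, le_rfl⟩
    have h3 := gm hay
    rw [h1, h2] at h3
    by_contra hneg
    nlinarith
  · have hd : HasDerivWithinAt (fun t : ℝ => m * t + q) m (Ici a) a := by
      simpa using (((hasDerivAt_id a).const_mul m).add_const q).hasDerivWithinAt
    refine hd.congr_of_eventuallyEq ?_ (hm a ⟨le_rfl, hay.le⟩)
    filter_upwards [self_mem_nhdsWithin, mem_nhdsWithin_of_mem_nhds (Iio_mem_nhds hay)]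
      with t h1 h2
    exact hm t ⟨h1, le_of_lt h2⟩

theorem exists_hasDeriv_right (g : PLo a c) :
    ∃ m : ℝ, 0 < m ∧ HasDerivWithinAt (g : ℝ ≃ₜ ℝ) m (Iic c) c := by
  obtain ⟨gm, ⟨B, hB⟩, -⟩ := g.2
  have hev : ∀ᶠ y in 𝓝[<] c, ∀ b ∈ B, b ∉ Ioo y c := by
    refine (Filter.eventually_all_finset B).2 fun b _ => ?_
    rcases le_or_gt c b with h | h
    · exact Eventually.of_forall fun y hy => absurd hy.2 (not_lt.2 h)
    · filter_upwards [mem_nhdsWithin_of_mem_nhds (Ioi_mem_nhds h)] with y hy hb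
      exact lt_asymm hy hb.1
  obtain ⟨y, hyB, hyc⟩ := (hev.and self_mem_nhdsWithin).exists
  have hyc : y < c := hyc
  obtain ⟨m, q, hm⟩ := hB y c hyc hyB
  refine ⟨m, ?_, ?_⟩
  · have h1 := hm c ⟨hyc.le, le_rfl⟩
    have h2 := hm y ⟨le_rfl, hyc.le⟩
    have h3 := gm hyc
    rw [h1, h2] at h3
    by_contra hneg
    nlinarith
  · have hd : HasDerivWithinAt (fun t : ℝ => m * t + q) m (Iic c) c := by
      simpa using (((hasDerivAt_id c).const_mul m).add_const q).hasDerivWithinAt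
    refine hd.congr_of_eventuallyEq ?_ (hm c ⟨hyc.le, le_rfl⟩)
    filter_upwards [self_mem_nhdsWithin, mem_nhdsWithin_of_mem_nhds (Ioi_mem_nhds hyc)]
      with t h1 h2
    exact hm t ⟨le_of_lt h2, h1⟩

theorem hasDeriv_left (g : PLo a c) :
    HasDerivWithinAt (g : ℝ ≃ₜ ℝ) (derivWithin (g : ℝ ≃ₜ ℝ) (Ici a) a) (Ici a) a := by
  obtain ⟨m, -, h⟩ := exists_hasDeriv_left g
  exact h.differentiableWithinAt.hasDerivWithinAt

theorem hasDeriv_right (g : PLo a c) :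
    HasDerivWithinAt (g : ℝ ≃ₜ ℝ) (derivWithin (g : ℝ ≃ₜ ℝ) (Iic c) c) (Iic c) c := by
  obtain ⟨m, -, h⟩ := exists_hasDeriv_right g
  exact h.differentiableWithinAt.hasDerivWithinAt

/-- `σ_ℓ : PL_o([a, c]) → ℝ_{>0}`, the right derivative in the left end point `a`. -/
noncomputable def sigmaLeft (a c : ℝ) : PLo a c →* {x : ℝ // 0 < x} :=
  MonoidHom.mk'
    (fun g => ⟨derivWithin (g : ℝ ≃ₜ ℝ) (Ici a) a, by
      obtain ⟨m, hm, h⟩ := exists_hasDeriv_left g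
      rwa [h.derivWithin (uniqueDiffWithinAt_Ici a)]⟩)
    (fun f g => Subtype.ext <| by
      have hf : HasDerivWithinAt (f : ℝ ≃ₜ ℝ) (derivWithin (f : ℝ ≃ₜ ℝ) (Ici a) a) (Ici a)
          ((g : ℝ ≃ₜ ℝ) a) := by simpa only [apply_left g] using hasDeriv_left f
      have hmap : MapsTo (g : ℝ ≃ₜ ℝ) (Ici a) (Ici a) := fun t (ht : a ≤ t) => by
        have := g.2.1.monotone ht
        rwa [apply_left g] at this
      have h := hf.comp a (hasDeriv_left g) hmap
      have h' := h.derivWithin (uniqueDiffWithinAt_Ici a)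
      exact h')

/-- `σ_r : PL_o([a, c]) → ℝ_{>0}`, the left derivative in the right end point `c`. -/
noncomputable def sigmaRight (a c : ℝ) : PLo a c →* {x : ℝ // 0 < x} :=
  MonoidHom.mk'
    (fun g => ⟨derivWithin (g : ℝ ≃ₜ ℝ) (Iic c) c, by
      obtain ⟨m, hm, h⟩ := exists_hasDeriv_right g
      rwa [h.derivWithin (uniqueDiffWithinAt_Iic c)]⟩)
    (fun f g => Subtype.ext <| by
      have hf : HasDerivWithinAt (f : ℝ ≃ₜ ℝ) (derivWithin (f : ℝ ≃ₜ ℝ) (Iic c) c) (Iic c)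
          ((g : ℝ ≃ₜ ℝ) c) := by simpa only [apply_right g] using hasDeriv_right f
      have hmap : MapsTo (g : ℝ ≃ₜ ℝ) (Iic c) (Iic c) := fun t (ht : t ≤ c) => by
        have := g.2.1.monotone ht
        rwa [apply_right g] at this
      have h := hf.comp c (hasDeriv_right g) hmap
      have h' := h.derivWithin (uniqueDiffWithinAt_Iic c)
      exact h')

/-! ### Characters, the character sphere and the invariant `Σ¹` of an arbitrary group -/

/-- The real vector space `Hom(G, ℝ)` of homomorphisms of `G` into the additive group `ℝ`. -/
abbrev Char (G : Type*) [Group G] := Additive G →+ ℝ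

/-- The character sphere `S(G)`: the set of open rays `ℝ_{>0} · χ`, for `χ` a non-zero
character. -/
abbrev CharSphere (G : Type*) [Group G] := Module.Ray ℝ (Char G)

/-- The submonoid `G_χ = {g ∈ G | χ(g) ≥ 0}`, as a set. -/
def nonnegPart {G : Type*} [Group G] (χ : Char G) : Set G :=
  {g | 0 ≤ χ (Additive.ofMul g)}

/-- `Γ(G, X)_χ`, the full subgraph on `G_χ` of the Cayley graph of `G` with respect to `X`, in
which `g` is joined to `g * x` for all `g ∈ G` and `x ∈ X`. -/
def cayleySubgraph {G : Type*} [Group G] (X : Set G) (χ : Char G) :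
    SimpleGraph (nonnegPart χ) :=
  (SimpleGraph.mulCayley X).induce (nonnegPart χ)

/-- `Σ¹(G)`: the set of the rays `[χ]` such that `Γ(G, X)_χ` is connected for every generating
set `X` of `G`. -/
def Sigma1 (G : Type*) [Group G] : Set (CharSphere G) :=
  {ξ | ∃ (χ : Char G) (hχ : χ ≠ 0), ξ = rayOfNeZero ℝ χ hχ ∧
    ∀ X : Set G, Subgroup.closure X = ⊤ → (cayleySubgraph X χ).Connected}

theorem nonnegPart_eq_of_sameRay {G : Type*} [Group G] {χ ψ : Char G} (hχ : χ ≠ 0) (hψ : ψ ≠ 0)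
    (h : SameRay ℝ χ ψ) : nonnegPart χ = nonnegPart ψ := by
  obtain ⟨r, s, hr, hs, h⟩ := h.exists_pos hχ hψ
  ext g
  have hg : r * χ (Additive.ofMul g) = s * ψ (Additive.ofMul g) := by
    simpa using DFunLike.congr_fun h (Additive.ofMul g)
  change 0 ≤ χ (Additive.ofMul g) ↔ 0 ≤ ψ (Additive.ofMul g)
  rw [← mul_nonneg_iff_of_pos_left hr, hg, mul_nonneg_iff_of_pos_left hs]

/-- Membership in `Σ¹(G)` does not depend on the character that represents the ray. -/
theorem mem_Sigma1_iff {G : Type*} [Group G] (χ : Char G) (hχ : χ ≠ 0) :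
    rayOfNeZero ℝ χ hχ ∈ Sigma1 G ↔
      ∀ X : Set G, Subgroup.closure X = ⊤ → (cayleySubgraph X χ).Connected := by
  constructor
  · rintro ⟨ψ, hψ, h, H⟩ X hX
    have e := nonnegPart_eq_of_sameRay hχ hψ ((ray_eq_iff hχ hψ).1 h)
    have := H X hX
    unfold cayleySubgraph at this ⊢
    rwa [e]
  · exact fun H => ⟨χ, hχ, rfl, H⟩

/-! ### Subgroups of `PL_o([a, c])` -/

/-- `G` is irreducible: no interior point of `[a, c]` is fixed by all of `G`. -/
def IsIrreducible (G : Subgroup (PLo a c)) : Prop :=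
  ∀ t ∈ Ioo a c, ∃ g ∈ G, (g : ℝ ≃ₜ ℝ) t ≠ t

/-- The restriction of `σ_ℓ` to `G`. -/
noncomputable def sigmaL (G : Subgroup (PLo a c)) : G →* {x : ℝ // 0 < x} :=
  (sigmaLeft a c).comp G.subtype

/-- The restriction of `σ_r` to `G`. -/
noncomputable def sigmaR (G : Subgroup (PLo a c)) : G →* {x : ℝ // 0 < x} :=
  (sigmaRight a c).comp G.subtype

/-- The character `ln ∘ σ` attached to a homomorphism `σ` into the positive reals. -/
noncomputable def logChar {G : Type*} [Group G] (σ : G →* {x : ℝ // 0 < x}) : Char G :=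
  AddMonoidHom.mk' (fun g => Real.log (σ g.toMul : ℝ)) fun g h => by
    rw [toMul_add, map_mul, Positive.val_mul, Real.log_mul (σ _).2.ne' (σ _).2.ne']

/-- `χ_ℓ = ln ∘ σ_ℓ`. -/
noncomputable def chiL (G : Subgroup (PLo a c)) : Char G := logChar (sigmaL G)

/-- `χ_r = ln ∘ σ_r`. -/
noncomputable def chiR (G : Subgroup (PLo a c)) : Char G := logChar (sigmaR G)

/-- `E(G)`: the rays represented by those among `χ_ℓ` and `χ_r` that are non-zero. -/
def exceptionalSet (G : Subgroup (PLo a c)) : Set (CharSphere G) :=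
  {ξ | (∃ h : chiL G ≠ 0, ξ = rayOfNeZero ℝ (chiL G) h) ∨
    (∃ h : chiR G ≠ 0, ξ = rayOfNeZero ℝ (chiR G) h)}

end PLSigma

namespace PLSigma

/-! ### Superlevel graphs of a character -/

section LevelGraph

variable {G : Type*} [Group G] {X : Set G} {χ : Char G}

/-! The only inputs are that every element is linear near each end of `[a, c]`, that irreducibility
moves supports apart by conjugation, and the torsion hypothesis. `sigma1_eq_of_isLinearGerm` works
from these alone, so that the two ends play symmetric roles.

A ray off `E(G)` lies in `Σ¹` by `connected_cayleySubgraph_of_commute`. If `χ y > 0`, the powers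
`yⁿ` determine an end of the superlevel graphs; when `G` fixes that end, every vertex can be joined
to it without descending, so the graph is connected. The end is fixed if, for each conjugate `z` of
`y`, one `w` with `χ w > 0` commutes with all `y⁻ⁿzⁿ`: climb from `yⁿ` along `w`, cross over high
up, come back down to `zⁿ`. If `χ` vanishes on neither kernel, take `y` from one kernel and `w`
conjugate to an element of the other, with support disjoint from those of `y` and `z`. If `χ`
vanishes on `ker σ` but is not on the ray of `log σ`, some `y` with `χ y > 0` contracts at that end,
and torsion allows `y ∈ ker σ'`. Then `y⁻ⁿzⁿ` is trivial on an interval independent of `n`, and a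
conjugate of `y` serves as `w`.

A ray in `E(G)` is excluded by `IsLinearGerm.exists_not_connected`: for the generators that are
linear with slope at most `1` on a fixed interval, connectedness would force `ker σ = 1`. Then `G`
is abelian, and torsion gives a contradiction at the other end. -/

theorem char_mul (χ : Char G) (g h : G) :
    χ (.ofMul (g * h)) = χ (.ofMul g) + χ (.ofMul h) := by
  rw [ofMul_mul, map_add]

theorem char_one (χ : Char G) : χ (.ofMul 1) = 0 := by
  rw [ofMul_one, map_zero]

theorem char_inv (χ : Char G) (g : G) : χ (.ofMul g⁻¹) = -χ (.ofMul g) := by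
  rw [ofMul_inv, map_neg]

theorem char_pow (χ : Char G) (g : G) (n : ℕ) : χ (.ofMul (g ^ n)) = n * χ (.ofMul g) := by
  rw [ofMul_pow, map_nsmul, nsmul_eq_mul]

/-- The part of the Cayley graph of `G` with respect to `X` on which `χ ≥ r`, as a graph
on all of `G`. -/
def levelGraph (X : Set G) (χ : Char G) (r : ℝ) : SimpleGraph G where
  Adj g h := (SimpleGraph.mulCayley X).Adj g h ∧ r ≤ χ (.ofMul g) ∧ r ≤ χ (.ofMul h)
  symm := ⟨fun _ _ h => ⟨h.1.symm, h.2.2, h.2.1⟩⟩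
  loopless := ⟨fun _ h => h.1.ne rfl⟩

theorem levelGraph_anti {r s : ℝ} (h : r ≤ s) : levelGraph X χ s ≤ levelGraph X χ r :=
  fun _ _ e => ⟨e.1, h.trans e.2.1, h.trans e.2.2⟩

theorem reachable_level_anti {r s : ℝ} (h : r ≤ s) {g k : G}
    (H : (levelGraph X χ s).Reachable g k) : (levelGraph X χ r).Reachable g k :=
  H.mono (levelGraph_anti h)

theorem reachable_level_translate (k : G) {r : ℝ} {g h : G}
    (H : (levelGraph X χ r).Reachable g h) :
    (levelGraph X χ (χ (.ofMul k) + r)).Reachable (k * g) (k * h) := by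
  let φ : levelGraph X χ r →g levelGraph X χ (χ (.ofMul k) + r) :=
    { toFun := fun g => k * g
      map_rel' := by
        rintro g h ⟨e, hg, hh⟩
        rw [SimpleGraph.mulCayley_adj'] at e
        refine ⟨?_, by rw [char_mul]; linarith, by rw [char_mul]; linarith⟩
        obtain ⟨hne, x, hx, e⟩ := e
        rw [SimpleGraph.mulCayley_adj']
        refine ⟨fun h' => hne (mul_left_cancel h'), x, hx, ?_⟩
        simpa only [mul_assoc, mul_right_inj] using e }
  exact H.map φ

theorem reachable_level_mul_gen {x : G} (hx : x ∈ X) {r : ℝ} {g : G} (hg : r ≤ χ (.ofMul g))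
    (hgx : r ≤ χ (.ofMul (g * x))) : (levelGraph X χ r).Reachable g (g * x) := by
  by_cases h : g = g * x
  · rw [← h]
  · exact SimpleGraph.Adj.reachable
      ⟨(SimpleGraph.mulCayley_adj' _ _ _).2 ⟨h, x, hx, Or.inl rfl⟩, hg, hgx⟩

theorem exists_reachable_level_one (hX : Subgroup.closure X = ⊤) (g : G) :
    ∃ r, (levelGraph X χ r).Reachable 1 g := by
  have hg : g ∈ Subgroup.closure X := hX ▸ Subgroup.mem_top g
  induction hg using Subgroup.closure_induction with
  | mem x hx =>
    refine ⟨min 0 (χ (.ofMul x)), ?_⟩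
    have := reachable_level_mul_gen (χ := χ) hx (r := min 0 (χ (.ofMul x))) (g := 1)
      (by rw [char_one]; exact min_le_left _ _) (by rw [one_mul]; exact min_le_right _ _)
    rwa [one_mul] at this
  | one => exact ⟨0, .rfl⟩
  | mul g h _ _ hg hh =>
    obtain ⟨r, hr⟩ := hg
    obtain ⟨s, hs⟩ := hh
    have := reachable_level_translate g hs
    rw [mul_one] at this
    exact ⟨min r (χ (.ofMul g) + s), (reachable_level_anti (min_le_left _ _) hr).trans
      (reachable_level_anti (min_le_right _ _) this)⟩
  | inv g _ hg =>
    obtain ⟨r, hr⟩ := hg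
    have := reachable_level_translate g⁻¹ hr
    rw [mul_one, inv_mul_cancel] at this
    exact ⟨_, this.symm⟩

/-- The loss `m` depends on `w` only: one path from `1` to `w` is translated to every starting
vertex. -/
theorem exists_reachable_level_mul (hX : Subgroup.closure X = ⊤) (w : G) :
    ∃ m, ∀ k, (levelGraph X χ (χ (.ofMul k) + m)).Reachable k (k * w) := by
  obtain ⟨m, hm⟩ := exists_reachable_level_one (χ := χ) hX w
  refine ⟨m, fun k => ?_⟩
  simpa only [mul_one] using reachable_level_translate k hm

/-- Losses do not accumulate, since each further step starts at least as high as `k`. -/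
theorem reachable_level_mul_pow {w : G} (hw : 0 ≤ χ (.ofMul w)) {m : ℝ}
    (hm : ∀ k, (levelGraph X χ (χ (.ofMul k) + m)).Reachable k (k * w)) (k : G) (j : ℕ) :
    (levelGraph X χ (χ (.ofMul k) + m)).Reachable k (k * w ^ j) := by
  induction j with
  | zero => rw [pow_zero, mul_one]
  | succ j ih =>
    refine ih.trans ?_
    rw [pow_succ, ← mul_assoc]
    refine reachable_level_anti ?_ (hm (k * w ^ j))
    rw [char_mul, char_pow]
    have : 0 ≤ (j : ℝ) * χ (.ofMul w) := by positivity
    linarith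

theorem eventually_le_nat_mul_add {t : ℝ} (ht : 0 < t) (m r : ℝ) :
    ∀ᶠ n : ℕ in atTop, r ≤ n * t + m :=
  (tendsto_atTop_add_const_right _ m
    (tendsto_natCast_atTop_atTop.atTop_mul_const ht)).eventually_ge_atTop r

/-- If some `w` with `χ w > 0` commutes with all `y⁻ⁿ zⁿ`, then the powers of `y` and of `z`
converge to the same end. -/
theorem eventually_reachable_level_pow_pow (hX : Subgroup.closure X = ⊤) {y z w : G}
    (hy : 0 < χ (.ofMul y)) (hz : 0 < χ (.ofMul z)) (hw : 0 < χ (.ofMul w))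
    (hcomm : ∀ n : ℕ, Commute w ((y ^ n)⁻¹ * z ^ n)) (r : ℝ) :
    ∀ᶠ n : ℕ in atTop, (levelGraph X χ r).Reachable (y ^ n) (z ^ n) := by
  obtain ⟨m, hm⟩ := exists_reachable_level_mul (χ := χ) hX w
  filter_upwards [eventually_le_nat_mul_add hy m r, eventually_le_nat_mul_add hz m r]
    with n hny hnz
  obtain ⟨m', hm'⟩ := exists_reachable_level_mul (χ := χ) hX ((y ^ n)⁻¹ * z ^ n)
  -- The crossing loses `m'`, which depends on `n`; `j` is chosen after `n` to climb high enough to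
  -- absorb it.
  obtain ⟨j, hj⟩ := (eventually_le_nat_mul_add hw (m' + n * χ (.ofMul y)) r).exists
  have h1 := reachable_level_mul_pow hw.le hm (y ^ n) j
  have h2 := hm' (y ^ n * w ^ j)
  have h3 := reachable_level_mul_pow hw.le hm (z ^ n) j
  have e : y ^ n * w ^ j * ((y ^ n)⁻¹ * z ^ n) = z ^ n * w ^ j := by
    rw [mul_assoc, ((hcomm n).pow_left j).eq, ← mul_assoc, mul_inv_cancel_left]
  rw [e] at h2
  refine ((reachable_level_anti ?_ h1).trans (reachable_level_anti ?_ h2)).trans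
    (reachable_level_anti ?_ h3).symm
  · rwa [char_pow]
  · rw [char_mul, char_pow, char_pow]; linarith
  · rwa [char_pow]

/-- Edges of `levelGraph` record the heights of both vertices, so its walks lift to the induced
subgraph. -/
theorem connected_cayleySubgraph_of_reachable
    (H : ∀ g : G, 0 ≤ χ (.ofMul g) → (levelGraph X χ 0).Reachable 1 g) :
    (cayleySubgraph X χ).Connected := by
  have key : ∀ g h : G, (levelGraph X χ 0).Walk g h →
      ∀ (hg : g ∈ nonnegPart χ) (hh : h ∈ nonnegPart χ),
        (cayleySubgraph X χ).Reachable ⟨g, hg⟩ ⟨h, hh⟩ := by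
    intro g h p
    induction p with
    | nil => exact fun _ _ => .rfl
    | cons e _ ih =>
      intro hg hh
      exact (SimpleGraph.Adj.reachable (G := cayleySubgraph X χ) (u := ⟨_, hg⟩)
        (v := ⟨_, e.2.2⟩) e.1).trans
        (ih e.2.2 hh)
  refine (SimpleGraph.connected_iff_exists_forall_reachable _).2
    ⟨⟨1, (char_one χ).ge⟩, fun g => ?_⟩
  obtain ⟨p⟩ := H g.1 g.2
  exact key _ _ p _ _

/-- If the end of `y` is invariant under `G`, then `Γ(G, X)_χ` is connected for every generating
set `X`. -/
theorem connected_cayleySubgraph_of_commute {y : G} (hy : 0 < χ (.ofMul y))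
    (hcomm : ∀ g : G, ∃ w : G, 0 < χ (.ofMul w) ∧
      ∀ n : ℕ, Commute w ((y ^ n)⁻¹ * (g * y * g⁻¹) ^ n))
    (hX : Subgroup.closure X = ⊤) : (cayleySubgraph X χ).Connected := by
  obtain ⟨m, hm⟩ := exists_reachable_level_mul (χ := χ) hX y
  have hinv : ∀ (h : G) (r : ℝ),
      ∀ᶠ n : ℕ in atTop, (levelGraph X χ r).Reachable (h * y ^ n) (y ^ n) := by
    intro h r
    obtain ⟨w, hw, hwc⟩ := hcomm h
    obtain ⟨m', hm'⟩ := exists_reachable_level_mul (χ := χ) hX h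
    have hz : χ (.ofMul (h * y * h⁻¹)) = χ (.ofMul y) := by
      rw [char_mul, char_mul, char_inv]; ring
    filter_upwards [eventually_reachable_level_pow_pow hX hy (hz.symm ▸ hy) hw hwc r,
      eventually_le_nat_mul_add hy m' r] with n h1 h2
    have h3 := hm' ((h * y * h⁻¹) ^ n)
    rw [char_pow, hz] at h3
    have e : (h * y * h⁻¹) ^ n * h = h * y ^ n := by rw [conj_pow, inv_mul_cancel_right]
    rw [e] at h3
    exact ((h1.trans (reachable_level_anti h2 h3))).symm
  have hend : ∀ h : G, ∀ r ≤ χ (.ofMul h) + m,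
      ∀ᶠ n : ℕ in atTop, (levelGraph X χ r).Reachable h (y ^ n) := by
    intro h r hr
    filter_upwards [hinv h r] with n hn
    exact (reachable_level_anti hr (reachable_level_mul_pow hy.le hm h n)).trans hn
  -- A generator on which `χ` is non-zero, or its inverse, climbs with loss `0`.
  obtain ⟨x, hx0, hx⟩ : ∃ x : G, 0 < χ (.ofMul x) ∧
      ∀ k, (levelGraph X χ (χ (.ofMul k) + 0)).Reachable k (k * x) := by
    obtain ⟨x, hxX, hx⟩ : ∃ x ∈ X, χ (.ofMul x) ≠ 0 := by
      by_contra! hall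
      have : Subgroup.closure X ≤ (AddMonoidHom.toMultiplicativeRight χ).ker :=
        (Subgroup.closure_le _).2 fun x hx => hall x hx
      rw [hX] at this
      exact hy.ne' (this (Subgroup.mem_top y))
    rcases hx.lt_or_gt with hx | hx
    · refine ⟨x⁻¹, by rw [char_inv]; linarith, fun k => ?_⟩
      have := reachable_level_mul_gen (χ := χ) hxX (r := χ (.ofMul k) + 0) (g := k * x⁻¹)
        (by rw [char_mul, char_inv]; linarith) (by rw [inv_mul_cancel_right, add_zero])
      rw [inv_mul_cancel_right] at this
      exact this.symm
    · exact ⟨x, hx, fun k => reachable_level_mul_gen hxX (add_zero _).le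
        (by rw [char_mul]; linarith)⟩
  have hend' : ∀ h : G, ∀ᶠ n : ℕ in atTop,
      (levelGraph X χ (χ (.ofMul h))).Reachable h (y ^ n) := by
    intro h
    -- A preliminary climb along `x` compensates the loss `m` on the way to the end.
    obtain ⟨j, hj⟩ := (eventually_le_nat_mul_add hx0 m 0).exists
    have h1 := reachable_level_mul_pow hx0.le hx h j
    rw [add_zero] at h1
    filter_upwards [hend (h * x ^ j) (χ (.ofMul h))
      (by rw [char_mul, char_pow]; linarith)] with n hn
    exact h1.trans hn
  refine connected_cayleySubgraph_of_reachable fun g hg => ?_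
  obtain ⟨n, h1, h2⟩ := ((hend' 1).and (hend' g)).exists
  rw [char_one] at h1
  exact h1.trans (reachable_level_anti hg h2).symm

end LevelGraph

/-! ### Groups with a linear germ at an end -/

section LinearGerm

variable {G : Type*} [Group G]

/-- `L ε g` behaves like the predicate "`g` is linear with slope `σ g` on the interval of length
`ε` at a fixed end". -/
structure IsLinearGerm (σ : G →* {x : ℝ // 0 < x}) (L : ℝ → G → Prop) : Prop where
  exists_pos : ∀ g, ∃ ε > 0, L ε g
  one : ∀ ε, L ε 1
  anti : ∀ {ε δ : ℝ} {g : G}, ε ≤ δ → L δ g → L ε g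
  mul : ∀ {ε : ℝ} {g h : G}, L ε g → L (σ g * ε) h → L ε (h * g)
  inv : ∀ {ε : ℝ} {g : G}, L ε g → L (σ g * ε) g⁻¹

theorem logChar_apply (σ : G →* {x : ℝ // 0 < x}) (g : G) :
    logChar σ (.ofMul g) = Real.log (σ g : ℝ) := rfl

theorem logChar_eq_zero_iff (σ : G →* {x : ℝ // 0 < x}) (g : G) :
    logChar σ (.ofMul g) = 0 ↔ σ g = 1 := by
  rw [logChar_apply, Real.log_eq_zero]
  have := (σ g).2
  constructor
  · rintro (h | h | h)
    · linarith
    · exact Subtype.ext h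
    · linarith
  · intro h
    exact Or.inr (Or.inl (congrArg Subtype.val h))

theorem logChar_neg_iff (σ : G →* {x : ℝ // 0 < x}) (g : G) :
    logChar σ (.ofMul g) < 0 ↔ (σ g : ℝ) < 1 := by
  rw [logChar_apply, Real.log_neg_iff (σ g).2]

theorem logChar_nonneg_iff (σ : G →* {x : ℝ // 0 < x}) (g : G) :
    0 ≤ logChar σ (.ofMul g) ↔ 1 ≤ (σ g : ℝ) := by
  rw [logChar_apply, Real.log_nonneg_iff (σ g).2]

theorem val_map_inv (σ : G →* {x : ℝ // 0 < x}) (g : G) : (σ g⁻¹ : ℝ) = (σ g : ℝ)⁻¹ := by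
  rw [map_inv]; rfl

theorem val_map_mul (σ : G →* {x : ℝ // 0 < x}) (g h : G) :
    (σ (g * h) : ℝ) = (σ g : ℝ) * (σ h : ℝ) := by
  rw [map_mul]; rfl

theorem val_map_pow (σ : G →* {x : ℝ // 0 < x}) (g : G) (n : ℕ) :
    (σ (g ^ n) : ℝ) = (σ g : ℝ) ^ n := by
  induction n with
  | zero => rw [pow_zero, pow_zero, map_one]; rfl
  | succ n ih => rw [pow_succ, pow_succ, val_map_mul, ih]

theorem map_conj_eq (σ : G →* {x : ℝ // 0 < x}) (g h : G) : σ (g * h * g⁻¹) = σ h := by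
  rw [map_mul, map_mul, map_inv, mul_comm, inv_mul_cancel_left]

theorem exists_map_lt_one {σ : G →* {x : ℝ // 0 < x}} (h : logChar σ ≠ 0) :
    ∃ f, (σ f : ℝ) < 1 := by
  obtain ⟨f, hf⟩ := DFunLike.ne_iff.1 h
  rw [AddMonoidHom.zero_apply] at hf
  rcases hf.lt_or_gt with hf | hf
  · exact ⟨f.toMul, (logChar_neg_iff σ f.toMul).1 hf⟩
  · refine ⟨f.toMul⁻¹, (logChar_neg_iff σ _).1 ?_⟩
    rw [char_inv]
    exact neg_neg_of_pos hf

/-! ### Characters on the exceptional rays -/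

namespace IsLinearGerm

variable {σ σ' : G →* {x : ℝ // 0 < x}} {L L' : ℝ → G → Prop}

theorem pow (hL : IsLinearGerm σ L) {f : G} (hf : (σ f : ℝ) ≤ 1) {ε : ℝ} (hε : 0 ≤ ε)
    (hfε : L ε f) (n : ℕ) : L ε (f ^ n) := by
  induction n with
  | zero => rw [pow_zero]; exact hL.one ε
  | succ n ih =>
    rw [pow_succ]
    exact hL.mul hfε (hL.anti (mul_le_of_le_one_left hε hf) ih)

/-- The elements that are linear with slope at most `1` on a fixed interval generate. -/
theorem closure_eq_top (hL : IsLinearGerm σ L) {f : G} (hf : (σ f : ℝ) < 1)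
    {ε : ℝ} (hε : 0 < ε) (hfε : L ε f) :
    Subgroup.closure {g | L ε g ∧ (σ g : ℝ) ≤ 1} = ⊤ := by
  have hle : ∀ g, (σ g : ℝ) ≤ 1 → g ∈ Subgroup.closure {g | L ε g ∧ (σ g : ℝ) ≤ 1} := by
    intro g hg
    obtain ⟨δ, hδ, hgδ⟩ := hL.exists_pos g
    -- `fⁿ` shrinks length `ε` below `δ`, so `f⁻ⁿ g fⁿ` is linear on length `ε`.
    obtain ⟨n, hn⟩ := exists_pow_lt_of_lt_one (div_pos hδ hε) hf
    rw [lt_div_iff₀ hε, ← val_map_pow] at hn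
    have hfn := hL.pow hf.le hε.le hfε n
    have h2 : L ε (g * f ^ n) := hL.mul hfn (hL.anti hn.le hgδ)
    have h3 : L ε ((f ^ n)⁻¹ * (g * f ^ n)) := by
      refine hL.mul h2 (hL.anti ?_ (hL.inv hfn))
      rw [val_map_mul, mul_assoc]
      exact mul_le_of_le_one_left (mul_pos (σ _).2 hε).le hg
    have hfm := Subgroup.pow_mem _ (Subgroup.subset_closure
      (show f ∈ {g | L ε g ∧ (σ g : ℝ) ≤ 1} from ⟨hfε, hf.le⟩)) n
    have hm : (f ^ n)⁻¹ * (g * f ^ n) ∈ Subgroup.closure {g | L ε g ∧ (σ g : ℝ) ≤ 1} := by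
      refine Subgroup.subset_closure ⟨h3, ?_⟩
      have := map_conj_eq σ (f ^ n)⁻¹ g
      rw [inv_inv, mul_assoc] at this
      rwa [this]
    have := Subgroup.mul_mem _ (Subgroup.mul_mem _ hfm hm) (Subgroup.inv_mem _ hfm)
    rwa [mul_inv_cancel_left, mul_inv_cancel_right] at this
  refine (Subgroup.eq_top_iff' _).2 fun g => ?_
  rcases le_total (σ g : ℝ) 1 with hg | hg
  · exact hle g hg
  · rw [← inv_inv g]
    refine Subgroup.inv_mem _ (hle _ ?_)
    rw [val_map_inv]
    exact inv_le_one_of_one_le₀ hg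

/-- Linearity of the inverse on length `ε` passes along each edge in both directions: slopes at
least `1` at the two vertices keep the images inside the range where the generator, or its inverse,
is linear. It holds at `1`, hence everywhere. -/
theorem linear_inv_of_connected (hL : IsLinearGerm σ L) {ε : ℝ} (hε : 0 < ε)
    (hconn : (cayleySubgraph {g | L ε g ∧ (σ g : ℝ) ≤ 1} (logChar σ)).Connected) {h : G}
    (hh : 1 ≤ (σ h : ℝ)) : L ε h⁻¹ := by
  have hstep : ∀ g x : G, 1 ≤ (σ g : ℝ) → 1 ≤ (σ (g * x) : ℝ) → L ε x →
      (L ε g⁻¹ ↔ L ε (g * x)⁻¹) := by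
    intro g x hg hgx hx
    have hpos := (σ g).2
    have hpos' := (σ (g * x)).2
    constructor
    · intro H
      rw [mul_inv_rev]
      refine hL.mul H (hL.anti ?_ (hL.inv hx))
      refine mul_le_mul_of_nonneg_right ?_ hε.le
      rw [val_map_inv, inv_le_iff_one_le_mul₀' hpos, ← val_map_mul]
      exact hgx
    · intro H
      have e : g⁻¹ = x * (g * x)⁻¹ := by group
      rw [e]
      refine hL.mul H (hL.anti ?_ hx)
      refine mul_le_of_le_one_left hε.le ?_
      rw [val_map_inv]
      exact inv_le_one_of_one_le₀ hgx
  have key : ∀ g k : nonnegPart (logChar σ),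
      (cayleySubgraph {g | L ε g ∧ (σ g : ℝ) ≤ 1} (logChar σ)).Walk g k →
      L ε g.1⁻¹ → L ε k.1⁻¹ := by
    intro g k p
    induction p with
    | nil => exact id
    | @cons u v _ e _ ih =>
      intro H
      refine ih ?_
      obtain ⟨-, x, hx, e⟩ := (SimpleGraph.mulCayley_adj' _ _ _).1 e
      have hu := (logChar_nonneg_iff σ _).1 u.2
      have hv := (logChar_nonneg_iff σ _).1 v.2
      rcases e with e | e
      · have e : u.1 * x = v.1 := e
        rw [← e] at hv ⊢
        exact (hstep _ _ hu hv hx.1).1 H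
      · have e : u.1 = v.1 * x := e
        rw [e] at hu H
        exact (hstep _ _ hv hu hx.1).2 H
  obtain ⟨p⟩ := hconn.preconnected ⟨1, (char_one _).ge⟩ ⟨h, (logChar_nonneg_iff σ h).2 hh⟩
  exact key _ _ p (by simpa using hL.one ε)

/-- A nontrivial logarithmic slope at an end does not represent a point of `Σ¹`. -/
theorem exists_not_connected (hL : IsLinearGerm σ L) (hL' : IsLinearGerm σ' L')
    (hfix : ∀ ε > 0, ∀ k, σ k = 1 → (∀ h, L ε (h * k * h⁻¹)) → k = 1)
    (hfix' : ∀ ε > 0, ∀ k, σ' k = 1 → (∀ h, L' ε (h * k * h⁻¹)) → k = 1)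
    (htor : ∀ g, ∃ n : ℕ, 0 < n ∧ ∃ k l, σ k = 1 ∧ σ' l = 1 ∧ g ^ n = k * l)
    (hσ : logChar σ ≠ 0) :
    ∃ X : Set G, Subgroup.closure X = ⊤ ∧ ¬(cayleySubgraph X (logChar σ)).Connected := by
  obtain ⟨f, hf⟩ := exists_map_lt_one hσ
  obtain ⟨ε, hε, hfε⟩ := hL.exists_pos f
  refine ⟨_, hL.closure_eq_top hf hε hfε, fun hconn => ?_⟩
  -- Conjugates of `k` and their inverses have slope `1`, so all are linear on the same length `ε`.
  have hker : ∀ k, σ k = 1 → k = 1 := by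
    refine fun k hk => hfix ε hε k hk fun h => ?_
    rw [← inv_inv (h * k * h⁻¹)]
    refine hL.linear_inv_of_connected hε hconn ?_
    rw [val_map_inv, map_conj_eq, hk]
    simp
  have hcomm : ∀ g h : G, h * g * h⁻¹ = g := by
    intro g h
    rw [← mul_inv_eq_one]
    refine hker _ ?_
    rw [map_mul, map_conj_eq, map_inv, mul_inv_cancel]
  -- A power of `f` lies in `ker σ'`, and the positive reals have no torsion.
  have hσ' : σ' f = 1 := by
    obtain ⟨n, hn, k, l, hk, hl, e⟩ := htor f
    rw [hker k hk, one_mul] at e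
    have := val_map_pow σ' f n
    rw [e, hl] at this
    exact Subtype.ext ((pow_eq_one_iff_of_nonneg (σ' f).2.le hn.ne').1 this.symm)
  obtain ⟨δ, hδ, hfδ⟩ := hL'.exists_pos f
  have := hfix' δ hδ f hσ' fun h => by rwa [hcomm]
  rw [this, map_one] at hf
  exact lt_irrefl _ hf

end IsLinearGerm

/-- Characters `χ`, `l` such that `l ≥ 0` where `χ > 0` and `χ = 0` where `l = 0` are on a ray. -/
theorem exists_pos_smul_eq {χ l : Char G} (hχ : χ ≠ 0)
    (h0 : ∀ g : G, l (.ofMul g) = 0 → χ (.ofMul g) = 0)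
    (hpos : ∀ g : G, 0 < χ (.ofMul g) → 0 ≤ l (.ofMul g)) :
    ∃ r : ℝ, 0 < r ∧ χ = r • l := by
  obtain ⟨y, hy⟩ : ∃ y : G, 0 < χ (.ofMul y) := by
    obtain ⟨f, hf⟩ := DFunLike.ne_iff.1 hχ
    rw [AddMonoidHom.zero_apply] at hf
    rcases hf.lt_or_gt with hf | hf
    · exact ⟨f.toMul⁻¹, by rw [char_inv]; exact neg_pos.2 hf⟩
    · exact ⟨f.toMul, hf⟩
  have hly : 0 < l (.ofMul y) := (hpos y hy).lt_of_ne fun h => hy.ne' (h0 y h.symm)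
  have hle : ∀ g : G, χ (.ofMul g) / χ (.ofMul y) ≤ l (.ofMul g) / l (.ofMul y) := by
    intro g
    by_contra! h
    -- With `q = p / d`, the element `gᵈ y⁻ᵖ` has `χ > 0` but `l < 0`.
    obtain ⟨q, hq1, hq2⟩ := exists_rat_btwn h
    rw [div_lt_iff₀ hly] at hq1
    rw [lt_div_iff₀ hy] at hq2
    have hd : (0 : ℝ) < q.den := by exact_mod_cast q.den_pos
    have hq : (q : ℝ) * q.den = q.num := by exact_mod_cast Rat.mul_den_eq_num q
    have hval : ∀ ψ : Char G, ψ (.ofMul (g ^ q.den * (y ^ q.num)⁻¹)) =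
        q.den * (ψ (.ofMul g) - q * ψ (.ofMul y)) := by
      intro ψ
      rw [char_mul, char_inv, char_pow, ofMul_zpow, map_zsmul, zsmul_eq_mul, ← hq]
      ring
    have h1 : 0 < χ (.ofMul (g ^ q.den * (y ^ q.num)⁻¹)) := by
      rw [hval]; exact mul_pos hd (sub_pos.2 hq2)
    have h2 := hpos _ h1
    rw [hval] at h2
    exact absurd h2 (not_le.2 (mul_neg_of_pos_of_neg hd (sub_neg.2 hq1)))
  refine ⟨χ (.ofMul y) / l (.ofMul y), div_pos hy hly, ?_⟩
  ext g
  change χ (.ofMul g) = χ (.ofMul y) / l (.ofMul y) * l (.ofMul g)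
  have h1 := hle g
  have h2 := hle g⁻¹
  rw [char_inv, char_inv, neg_div, neg_div, neg_le_neg_iff] at h2
  have := le_antisymm h1 h2
  field_simp at this ⊢
  linarith

/-! ### Characters off the exceptional rays -/

namespace IsLinearGerm

variable {σ σ' : G →* {x : ℝ // 0 < x}} {L L' : ℝ → G → Prop}

/-- Two contractions with the same slope have powers that agree on a fixed interval. -/
theorem exists_pow_inv_mul_pow (hL : IsLinearGerm σ L) {y z : G}
    (hy : (σ y : ℝ) < 1) (hz : σ z = σ y) :
    ∃ ε > 0, ∀ n : ℕ, σ ((y ^ n)⁻¹ * z ^ n) = 1 ∧ L ε ((y ^ n)⁻¹ * z ^ n) := by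
  obtain ⟨ε, hε, hyε⟩ := hL.exists_pos y
  obtain ⟨δ, hδ, hzδ⟩ := hL.exists_pos z
  have hm : 0 < min ε δ := lt_min hε hδ
  refine ⟨min ε δ, hm, fun n => ⟨?_, ?_⟩⟩
  · rw [map_mul, map_inv, map_pow, map_pow, hz, inv_mul_cancel]
  · have h2 := hL.pow hy.le hm.le (hL.anti (min_le_left _ _) hyε) n
    have h3 := hL.pow (hz ▸ hy.le) hm.le (hL.anti (min_le_right _ _) hzδ) n
    refine hL.mul h3 (hL.anti (le_of_eq ?_) (hL.inv h2))
    rw [map_pow, map_pow, hz]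

/-- The criterion for a character that vanishes on the kernel of the slope at an end. -/
theorem connected_of_ker_le (hL : IsLinearGerm σ L) (hL' : IsLinearGerm σ' L')
    (hsep : ∀ ε > 0, ∀ δ > 0, ∃ h, ∀ u v, σ u = 1 → L ε u → σ' v = 1 → L' δ v →
      Commute (h * v * h⁻¹) u)
    (htor : ∀ g, ∃ n : ℕ, 0 < n ∧ ∃ k l, σ k = 1 ∧ σ' l = 1 ∧ g ^ n = k * l)
    {χ : Char G} (hχ : χ ≠ 0) (hker : ∀ k, σ k = 1 → χ (.ofMul k) = 0)
    (hray : ∀ r : ℝ, 0 < r → χ ≠ r • logChar σ) {X : Set G} (hX : Subgroup.closure X = ⊤) :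
    (cayleySubgraph X χ).Connected := by
  -- Otherwise `σ ≥ 1` wherever `χ > 0`, which puts `χ` on the ray of `logChar σ`.
  obtain ⟨y₀, hy₀, hσy₀⟩ : ∃ y, 0 < χ (.ofMul y) ∧ (σ y : ℝ) < 1 := by
    by_contra! H
    obtain ⟨r, hr, e⟩ := exists_pos_smul_eq (l := logChar σ) hχ
      (fun g hg => hker g ((logChar_eq_zero_iff σ g).1 hg))
      (fun g hg => (logChar_nonneg_iff σ g).2 (H g hg))
    exact hray r hr e
  -- Neither `χ` nor `σ` sees the factor `k`, so `y ∈ ker σ'` inherits both inequalities.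
  obtain ⟨n, hn, k, y, hk, hy, e⟩ := htor y₀
  have hχy : 0 < χ (.ofMul y) := by
    have := congrArg (fun g => χ (.ofMul g)) e
    simp only [char_pow, char_mul, hker k hk, zero_add] at this
    rw [← this]
    positivity
  have hσy : (σ y : ℝ) < 1 := by
    have := congrArg σ e
    rw [map_mul, hk, one_mul] at this
    rw [← this, val_map_pow]
    exact pow_lt_one₀ (σ y₀).2.le hσy₀ hn.ne'
  obtain ⟨δ, hδ, hyδ⟩ := hL'.exists_pos y
  refine connected_cayleySubgraph_of_commute hχy (fun g => ?_) hX
  obtain ⟨ε, hε, hyz⟩ := hL.exists_pow_inv_mul_pow hσy (map_conj_eq σ g y)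
  obtain ⟨h, hh⟩ := hsep ε hε δ hδ
  refine ⟨h * y * h⁻¹, ?_, fun n => hh _ _ (hyz n).1 (hyz n).2 hy hyδ⟩
  rw [char_mul, char_mul, char_inv]
  linarith

/-- The criterion for a character that vanishes on neither of the two kernels. -/
theorem connected_of_ne_zero (hL : IsLinearGerm σ L) (hL' : IsLinearGerm σ' L')
    (hsep : ∀ ε > 0, ∀ δ > 0, ∃ h, ∀ u v, σ u = 1 → L ε u → σ' v = 1 → L' δ v →
      Commute (h * v * h⁻¹) u) {χ : Char G}
    {k l : G} (hk : σ k = 1) (hχk : 0 < χ (.ofMul k)) (hl : σ' l = 1) (hχl : 0 < χ (.ofMul l))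
    {X : Set G} (hX : Subgroup.closure X = ⊤) : (cayleySubgraph X χ).Connected := by
  obtain ⟨δ, hδ, hlδ⟩ := hL'.exists_pos l
  refine connected_cayleySubgraph_of_commute hχk (fun g => ?_) hX
  obtain ⟨ε, hε, hkε⟩ := hL.exists_pos k
  obtain ⟨ε', hε', hgε⟩ := hL.exists_pos (g * k * g⁻¹)
  obtain ⟨h, hh⟩ := hsep (min ε ε') (lt_min hε hε') δ hδ
  refine ⟨h * l * h⁻¹, ?_, fun n => ?_⟩
  · rw [char_mul, char_mul, char_inv]
    linarith
  · have h2 := hh k l hk (hL.anti (min_le_left _ _) hkε) hl hlδ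
    have h3 := hh (g * k * g⁻¹) l ((map_conj_eq σ g k).trans hk)
      (hL.anti (min_le_right _ _) hgε) hl hlδ
    exact (h2.pow_right n).inv_right.mul_right (h3.pow_right n)

end IsLinearGerm

theorem rayOfNeZero_eq_of_eq_smul {χ l : Char G} (hχ : χ ≠ 0) {r : ℝ} (hr : 0 < r)
    (e : χ = r • l) : ∃ hl : l ≠ 0, rayOfNeZero ℝ χ hχ = rayOfNeZero ℝ l hl := by
  have hl : l ≠ 0 := by
    rintro rfl
    exact hχ (by rw [e, smul_zero])
  refine ⟨hl, (ray_eq_iff _ _).2 ?_⟩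
  rw [e]
  exact SameRay.sameRay_pos_smul_left l hr

theorem exists_pos_of_ne_zero_on_ker {σ : G →* {x : ℝ // 0 < x}} {χ : Char G}
    (h : ¬∀ k, σ k = 1 → χ (.ofMul k) = 0) : ∃ k, σ k = 1 ∧ 0 < χ (.ofMul k) := by
  push Not at h
  obtain ⟨k, hk, hne⟩ := h
  rcases hne.lt_or_gt with h | h
  · exact ⟨k⁻¹, by rw [map_inv, hk, inv_one], by rw [char_inv]; exact neg_pos.2 h⟩
  · exact ⟨k, hk, h⟩

/-- `Σ¹` of a group with a linear germ at each of two ends. -/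
theorem sigma1_eq_of_isLinearGerm {σ σ' : G →* {x : ℝ // 0 < x}} {L L' : ℝ → G → Prop}
    (hL : IsLinearGerm σ L) (hL' : IsLinearGerm σ' L')
    (hfix : ∀ ε > 0, ∀ k, σ k = 1 → (∀ h, L ε (h * k * h⁻¹)) → k = 1)
    (hfix' : ∀ ε > 0, ∀ k, σ' k = 1 → (∀ h, L' ε (h * k * h⁻¹)) → k = 1)
    (hsep : ∀ ε > 0, ∀ δ > 0, ∃ h, ∀ u v, σ u = 1 → L ε u → σ' v = 1 → L' δ v →
      Commute (h * v * h⁻¹) u)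
    (htor : ∀ g, ∃ n : ℕ, 0 < n ∧ ∃ k l, σ k = 1 ∧ σ' l = 1 ∧ g ^ n = k * l) :
    Sigma1 G = univ \ {ξ | (∃ h : logChar σ ≠ 0, ξ = rayOfNeZero ℝ (logChar σ) h) ∨
      (∃ h : logChar σ' ≠ 0, ξ = rayOfNeZero ℝ (logChar σ') h)} := by
  have htor' : ∀ g, ∃ n : ℕ, 0 < n ∧ ∃ k l, σ' k = 1 ∧ σ l = 1 ∧ g ^ n = k * l := by
    intro g
    obtain ⟨n, hn, k, l, hk, hl, e⟩ := htor g
    -- The two factors change places by `k l = (k l k⁻¹) k`.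
    exact ⟨n, hn, k * l * k⁻¹, k, (map_conj_eq σ' k l).trans hl, hk,
      by rw [e, inv_mul_cancel_right]⟩
  have hsep' : ∀ ε > 0, ∀ δ > 0, ∃ h, ∀ u v, σ' u = 1 → L' ε u → σ v = 1 → L δ v →
      Commute (h * v * h⁻¹) u := by
    intro ε hε δ hδ
    obtain ⟨h, hh⟩ := hsep δ hδ ε hε
    refine ⟨h⁻¹, fun u v hu hLu hv hLv => ?_⟩
    have := (hh v u hv hLv hu hLu).symm
    rw [commute_iff_eq] at this ⊢
    rw [inv_inv]
    calc h⁻¹ * v * h * u = h⁻¹ * (v * (h * u * h⁻¹)) * h := by group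
      _ = h⁻¹ * (h * u * h⁻¹ * v) * h := by rw [this]
      _ = u * (h⁻¹ * v * h) := by group
  ext ξ
  induction ξ using Module.Ray.ind with
  | h χ hχ =>
  rw [mem_Sigma1_iff χ hχ]
  constructor
  · rintro H
    refine ⟨mem_univ _, ?_⟩
    rintro (⟨h, e⟩ | ⟨h, e⟩)
    · obtain ⟨X, hX, hX'⟩ := hL.exists_not_connected hL' hfix hfix' htor h
      exact hX' ((mem_Sigma1_iff _ h).1 (e ▸ (mem_Sigma1_iff χ hχ).2 H) X hX)
    · obtain ⟨X, hX, hX'⟩ := hL'.exists_not_connected hL hfix' hfix htor' h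
      exact hX' ((mem_Sigma1_iff _ h).1 (e ▸ (mem_Sigma1_iff χ hχ).2 H) X hX)
  · rintro ⟨-, H⟩ X hX
    by_cases hk : ∀ k, σ k = 1 → χ (.ofMul k) = 0
    · refine hL.connected_of_ker_le hL' hsep htor hχ hk (fun r hr e => H (Or.inl ?_)) hX
      exact rayOfNeZero_eq_of_eq_smul hχ hr e
    by_cases hl : ∀ k, σ' k = 1 → χ (.ofMul k) = 0
    · refine hL'.connected_of_ker_le hL hsep' htor' hχ hl (fun r hr e => H (Or.inr ?_)) hX
      exact rayOfNeZero_eq_of_eq_smul hχ hr e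
    obtain ⟨k, hk, hχk⟩ := exists_pos_of_ne_zero_on_ker hk
    obtain ⟨l, hl, hχl⟩ := exists_pos_of_ne_zero_on_ker hl
    exact hL.connected_of_ne_zero hL' hsep hk hχk hl hχl hX

end LinearGerm

/-! ### The germs of `G` at the end points of `[a, c]` -/

section Ends

variable {a c : ℝ} {G : Subgroup (PLo a c)}

/-- `g` is linear with slope `σ g` on the interval of length `ε` that starts in `p` in the
direction `s`. -/
def LinearNear (σ : G →* {x : ℝ // 0 < x}) (p s ε : ℝ) (g : G) : Prop :=
  ∀ t ∈ Icc 0 ε, (g : ℝ ≃ₜ ℝ) (p + s * t) = p + s * (σ g * t)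

theorem coe_mul_apply (g h : G) (x : ℝ) :
    ((g * h : G) : ℝ ≃ₜ ℝ) x = (g : ℝ ≃ₜ ℝ) ((h : ℝ ≃ₜ ℝ) x) := rfl

theorem coe_inv_apply_apply (g : G) (x : ℝ) :
    ((g⁻¹ : G) : ℝ ≃ₜ ℝ) ((g : ℝ ≃ₜ ℝ) x) = x := by
  rw [← coe_mul_apply, inv_mul_cancel]; rfl

theorem coe_apply_inv_apply (g : G) (x : ℝ) :
    (g : ℝ ≃ₜ ℝ) (((g⁻¹ : G) : ℝ ≃ₜ ℝ) x) = x := by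
  rw [← coe_mul_apply, mul_inv_cancel]; rfl

theorem strictMono_coe (g : G) : StrictMono (g : ℝ ≃ₜ ℝ) := g.1.2.1

theorem isLinearGerm_linearNear {σ : G →* {x : ℝ // 0 < x}} {p s : ℝ}
    (h : ∀ g, ∃ ε > 0, LinearNear σ p s ε g) : IsLinearGerm σ (LinearNear σ p s) where
  exists_pos := h
  one ε t _ := by
    rw [map_one]
    change p + s * t = p + s * (1 * t)
    rw [one_mul]
  anti hle hg t ht := hg t ⟨ht.1, ht.2.trans hle⟩
  mul {ε g h} hg hh t ht := by
    have hpos := (σ g).2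
    rw [coe_mul_apply, hg t ht, hh _ ⟨mul_nonneg hpos.le ht.1,
      mul_le_mul_of_nonneg_left ht.2 hpos.le⟩, val_map_mul, mul_assoc]
  inv {ε g} hg t ht := by
    have hpos := (σ g).2
    have hm : t / (σ g : ℝ) ∈ Icc 0 ε :=
      ⟨div_nonneg ht.1 hpos.le, (div_le_iff₀' hpos).2 ht.2⟩
    have := hg _ hm
    rw [mul_div_cancel₀ _ hpos.ne'] at this
    rw [← this, coe_inv_apply_apply, val_map_inv, div_eq_inv_mul]

theorem exists_linearNear_left (g : G) : ∃ ε > 0, LinearNear (sigmaL G) a 1 ε g := by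
  obtain ⟨gm, ⟨B, hB⟩, -⟩ := g.1.2
  have hev : ∀ᶠ y in 𝓝[>] a, ∀ b ∈ B, b ∉ Ioo a y := by
    refine (Filter.eventually_all_finset B).2 fun b _ => ?_
    rcases le_or_gt b a with h | h
    · exact Eventually.of_forall fun y hy => absurd hy.1 (not_lt.2 h)
    · filter_upwards [mem_nhdsWithin_of_mem_nhds (Iio_mem_nhds h)] with y hy hb
      exact lt_asymm hy hb.2
  obtain ⟨y, hyB, hay⟩ := (hev.and self_mem_nhdsWithin).exists
  have hay : a < y := hay
  obtain ⟨m, q, hm⟩ := hB a y hay hyB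
  have ha := hm a ⟨le_rfl, hay.le⟩
  rw [apply_left] at ha
  have hd : HasDerivWithinAt (g : ℝ ≃ₜ ℝ) m (Ici a) a := by
    have hd : HasDerivWithinAt (fun t : ℝ => m * t + q) m (Ici a) a := by
      simpa using (((hasDerivAt_id a).const_mul m).add_const q).hasDerivWithinAt
    refine hd.congr_of_eventuallyEq ?_ (hm a ⟨le_rfl, hay.le⟩)
    filter_upwards [self_mem_nhdsWithin, mem_nhdsWithin_of_mem_nhds (Iio_mem_nhds hay)]
      with t h1 h2
    exact hm t ⟨h1, le_of_lt h2⟩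
  have hσ : (sigmaL G g : ℝ) = m := hd.derivWithin (uniqueDiffWithinAt_Ici a)
  refine ⟨y - a, sub_pos.2 hay, fun t ht => ?_⟩
  rw [hσ, one_mul, one_mul, hm _ ⟨by linarith [ht.1], by linarith [ht.2]⟩]
  linarith

theorem exists_linearNear_right (g : G) : ∃ ε > 0, LinearNear (sigmaR G) c (-1) ε g := by
  obtain ⟨gm, ⟨B, hB⟩, -⟩ := g.1.2
  have hev : ∀ᶠ y in 𝓝[<] c, ∀ b ∈ B, b ∉ Ioo y c := by
    refine (Filter.eventually_all_finset B).2 fun b _ => ?_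
    rcases le_or_gt c b with h | h
    · exact Eventually.of_forall fun y hy => absurd hy.2 (not_lt.2 h)
    · filter_upwards [mem_nhdsWithin_of_mem_nhds (Ioi_mem_nhds h)] with y hy hb
      exact lt_asymm hy hb.1
  obtain ⟨y, hyB, hyc⟩ := (hev.and self_mem_nhdsWithin).exists
  have hyc : y < c := hyc
  obtain ⟨m, q, hm⟩ := hB y c hyc hyB
  have hc := hm c ⟨hyc.le, le_rfl⟩
  rw [apply_right] at hc
  have hd : HasDerivWithinAt (g : ℝ ≃ₜ ℝ) m (Iic c) c := by
    have hd : HasDerivWithinAt (fun t : ℝ => m * t + q) m (Iic c) c := by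
      simpa using (((hasDerivAt_id c).const_mul m).add_const q).hasDerivWithinAt
    refine hd.congr_of_eventuallyEq ?_ (hm c ⟨hyc.le, le_rfl⟩)
    filter_upwards [self_mem_nhdsWithin, mem_nhdsWithin_of_mem_nhds (Ioi_mem_nhds hyc)]
      with t h1 h2
    exact hm t ⟨le_of_lt h2, h1⟩
  have hσ : (sigmaR G g : ℝ) = m := hd.derivWithin (uniqueDiffWithinAt_Iic c)
  refine ⟨c - y, sub_pos.2 hyc, fun t ht => ?_⟩
  rw [hσ, hm _ ⟨by linarith [ht.2], by linarith [ht.1]⟩]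
  linarith

/-! ### Elements of slope one, orbits and disjoint supports -/

theorem LinearNear.eqOn_left {σ : G →* {x : ℝ // 0 < x}} {ε : ℝ} {g : G}
    (h : LinearNear σ a 1 ε g) (hσ : σ g = 1) : ∀ x ≤ a + ε, (g : ℝ ≃ₜ ℝ) x = x := by
  intro x hx
  rcases lt_or_ge x a with hxa | hxa
  · exact g.1.2.2.2 x fun hm => absurd hm.1 (not_le.2 hxa)
  · have := h (x - a) ⟨by linarith, by linarith⟩
    rw [hσ, Positive.val_one] at this
    simpa using this

theorem LinearNear.eqOn_right {σ : G →* {x : ℝ // 0 < x}} {ε : ℝ} {g : G}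
    (h : LinearNear σ c (-1) ε g) (hσ : σ g = 1) : ∀ x, c - ε ≤ x → (g : ℝ ≃ₜ ℝ) x = x := by
  intro x hx
  rcases lt_or_ge c x with hxc | hxc
  · exact g.1.2.2.2 x fun hm => absurd hm.2 (not_le.2 hxc)
  · have := h (c - x) ⟨by linarith, by linarith⟩
    rw [hσ, Positive.val_one] at this
    simpa using this

theorem eq_one_of_forall_Ioo {k : G} (h : ∀ x ∈ Ioo a c, (k : ℝ ≃ₜ ℝ) x = x) : k = 1 := by
  refine Subtype.ext (Subtype.ext (Homeomorph.ext fun x => ?_))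
  change (k : ℝ ≃ₜ ℝ) x = x
  by_cases hx : x ∈ Icc a c
  · rcases hx.1.eq_or_lt with rfl | h1
    · exact apply_left _
    rcases hx.2.eq_or_lt with rfl | h2
    · exact apply_right _
    exact h x ⟨h1, h2⟩
  · exact k.1.2.2.2 x hx

/-- An irreducible group moves every interior point arbitrarily close to the left end. -/
theorem exists_apply_lt (hirr : IsIrreducible G) {s t : ℝ} (hs : s ∈ Ioo a c) (ht : a < t) :
    ∃ h : G, (h : ℝ ≃ₜ ℝ) s < t := by
  by_contra! H
  have hbdd : BddBelow (range fun h : G => (h : ℝ ≃ₜ ℝ) s) :=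
    ⟨t, by rintro _ ⟨h, rfl⟩; exact H h⟩
  set i := sInf (range fun h : G => (h : ℝ ≃ₜ ℝ) s) with hi
  have hti : t ≤ i := le_csInf (range_nonempty _) (by rintro _ ⟨h, rfl⟩; exact H h)
  have his : i ≤ s := csInf_le hbdd ⟨1, rfl⟩
  -- No element lowers the infimum of an orbit; applied to inverses, this makes it a global fixed
  -- point.
  have key : ∀ k : G, i ≤ (k : ℝ ≃ₜ ℝ) i := by
    intro k
    by_contra! hk
    have hk' := strictMono_coe k⁻¹ hk
    rw [coe_inv_apply_apply] at hk'
    obtain ⟨_, ⟨h, rfl⟩, hh⟩ := exists_lt_of_csInf_lt (range_nonempty _) (hi ▸ hk')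
    have hlt := strictMono_coe k hh
    rw [coe_apply_inv_apply, ← coe_mul_apply] at hlt
    exact absurd (csInf_le hbdd ⟨k * h, rfl⟩) (not_le.2 hlt)
  obtain ⟨g, hg, hne⟩ := hirr i ⟨ht.trans_le hti, his.trans_lt hs.2⟩
  refine hne (le_antisymm ?_ (key ⟨g, hg⟩))
  have := (strictMono_coe ⟨g, hg⟩).monotone (key (⟨g, hg⟩ : G)⁻¹)
  rwa [coe_apply_inv_apply] at this

/-- Each interior `x` is moved by some `g` to within `ε` of `a`, where `g k g⁻¹` is the identity;
hence `k` fixes `x`. -/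
theorem eq_one_of_conj_linearNear_left (hirr : IsIrreducible G)
    {σ : G →* {x : ℝ // 0 < x}} {ε : ℝ} (hε : 0 < ε) {k : G} (hk : σ k = 1)
    (h : ∀ h, LinearNear σ a 1 ε (h * k * h⁻¹)) : k = 1 := by
  refine eq_one_of_forall_Ioo fun x hx => ?_
  obtain ⟨g, hg⟩ := exists_apply_lt hirr hx (lt_add_of_pos_right a hε)
  have := (h g).eqOn_left ((map_conj_eq σ g k).trans hk) _ hg.le
  rw [coe_mul_apply, coe_inv_apply_apply, coe_mul_apply] at this
  exact (strictMono_coe g).injective this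

theorem eq_one_of_conj_linearNear_right (hirr : IsIrreducible G)
    {σ : G →* {x : ℝ // 0 < x}} {ε : ℝ} (hε : 0 < ε) {k : G} (hk : σ k = 1)
    (h : ∀ h, LinearNear σ c (-1) ε (h * k * h⁻¹)) : k = 1 := by
  refine eq_one_of_forall_Ioo fun x hx => ?_
  -- Pushing this point left of `x` means that `g⁻¹` pushes `x` right of `c - ε`.
  obtain ⟨g, hg⟩ := exists_apply_lt hirr (s := max (c - ε) x)
    ⟨hx.1.trans_le (le_max_right _ _), max_lt (by linarith) hx.2⟩ hx.1
  have hg' := strictMono_coe g⁻¹ hg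
  rw [coe_inv_apply_apply] at hg'
  have := (h g⁻¹).eqOn_right ((map_conj_eq σ g⁻¹ k).trans hk) _
    ((le_max_left _ _).trans hg'.le)
  rw [coe_mul_apply, inv_inv, coe_apply_inv_apply, coe_mul_apply] at this
  exact (strictMono_coe g⁻¹).injective this

theorem commute_of_disjoint_support {u v : G} {p q : ℝ} (hpq : p ≤ q)
    (hu : ∀ x ≤ q, (u : ℝ ≃ₜ ℝ) x = x) (hv : ∀ x, p ≤ x → (v : ℝ ≃ₜ ℝ) x = x) :
    Commute v u := by
  refine Subtype.ext (Subtype.ext (Homeomorph.ext fun x => ?_))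
  change (v : ℝ ≃ₜ ℝ) ((u : ℝ ≃ₜ ℝ) x) = (u : ℝ ≃ₜ ℝ) ((v : ℝ ≃ₜ ℝ) x)
  rcases le_total x p with hx | hx
  · have hvx := (strictMono_coe v).monotone hx
    rw [hv p le_rfl] at hvx
    rw [hu x (hx.trans hpq), hu _ (hvx.trans hpq)]
  · have hux : p ≤ (u : ℝ ≃ₜ ℝ) x := by
      have := (strictMono_coe u).monotone hx
      rwa [hu p hpq] at this
    rw [hv x hx, hv _ hux]

/-- Conjugation by `h` squeezes the support of `v` into the interval near `a` where `u` is the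
identity. One `h` serves all `u` and `v`, as needed for the family `y⁻ⁿzⁿ`. -/
theorem exists_conj_commute (hac : a < c) (hirr : IsIrreducible G)
    {σ σ' : G →* {x : ℝ // 0 < x}} {ε δ : ℝ} (hε : 0 < ε) (hδ : 0 < δ) :
    ∃ h : G, ∀ u v : G, σ u = 1 → LinearNear σ a 1 ε u → σ' v = 1 → LinearNear σ' c (-1) δ v →
      Commute (h * v * h⁻¹) u := by
  -- `v` is the identity from `s` on, so `h v h⁻¹` is the identity from `h s < a + ε` on.
  obtain ⟨s, hs1, hs2⟩ := exists_between (max_lt hac (sub_lt_self c hδ))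
  obtain ⟨h, hh⟩ := exists_apply_lt hirr ⟨(le_max_left _ _).trans_lt hs1, hs2⟩
    (lt_add_of_pos_right a hε)
  refine ⟨h, fun u v hu hLu hv hLv =>
    commute_of_disjoint_support hh.le (hLu.eqOn_left hu) fun x hx => ?_⟩
  have hx' := (strictMono_coe h⁻¹).monotone hx
  rw [coe_inv_apply_apply] at hx'
  rw [coe_mul_apply, coe_mul_apply,
    hLv.eqOn_right hv _ (((le_max_right _ _).trans hs1.le).trans hx'), coe_apply_inv_apply]

theorem exists_pow_eq_mul_of_isMulTorsion {H A B : Type*} [Group H] [Group A] [Group B]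
    {σ : H →* A} {σ' : H →* B} (htor : IsMulTorsion (H ⧸ (σ.ker ⊔ σ'.ker))) (g : H) :
    ∃ n : ℕ, 0 < n ∧ ∃ k l, σ k = 1 ∧ σ' l = 1 ∧ g ^ n = k * l := by
  obtain ⟨n, hn, e⟩ := isOfFinOrder_iff_pow_eq_one.1 (htor (g : H ⧸ (σ.ker ⊔ σ'.ker)))
  rw [← QuotientGroup.mk_pow, QuotientGroup.eq_one_iff,
    Subgroup.mem_sup_of_normal_right (t := σ'.ker)] at e
  obtain ⟨k, hk, l, hl, e⟩ := e
  exact ⟨n, hn, k, l, hk, hl, e.symm⟩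

end Ends

end PLSigma

theorem theorem1p1 {a c : ℝ} (hac : a < c) (G : Subgroup (PLSigma.PLo a c))
    (hirr : PLSigma.IsIrreducible G)
    (htor : IsMulTorsion (G ⧸ ((PLSigma.sigmaL G).ker ⊔ (PLSigma.sigmaR G).ker))) :
    PLSigma.Sigma1 G = Set.univ \ PLSigma.exceptionalSet G :=
  PLSigma.sigma1_eq_of_isLinearGerm
    (PLSigma.isLinearGerm_linearNear PLSigma.exists_linearNear_left)
    (PLSigma.isLinearGerm_linearNear PLSigma.exists_linearNear_right)
    (fun _ hε _ hk h => PLSigma.eq_one_of_conj_linearNear_left hirr hε hk h)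
    (fun _ hε _ hk h => PLSigma.eq_one_of_conj_linearNear_right hirr hε hk h)
    (fun _ hε _ hδ => PLSigma.exists_conj_commute hac hirr hε hδ)
    (PLSigma.exists_pow_eq_mul_of_isMulTorsion htor)
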